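/- For a matroid $\mathsf M$ on a finite set $E$ let $\mathcal L(\mathsf M)$ be its lattice of flats, and let $\mu(\mathsf M)$ be the value of the Möbius function of $\mathcal L(\mathsf M)$ on the interval from its bottom to its top element. Call a polynomial $f$ palindromic of degree $d$ if $\deg f\le d$ and $x^{d}f(x^{-1})=f(x)$. The Kazhdan–Lusztig polynomials $P_{\mathsf M}(x)$ and the inverse Kazhdan–Lusztig polynomials $Q_{\mathsf M}(x)$ are the unique families in $\mathbb Z[x]$, indexed by loopless matroids, such that $P_{\mathsf M}=Q_{\mathsf M}=1$ if $\operatorname{rk}(\mathsf M)=0$, such that $\deg P_{\mathsf M},\ \deg Q_{\mathsf M}<\tfrac12\operatorname{rk}(\mathsf M)$ if $\operatorname{rk}(\mathsf M)>0$, and such that the polynomials $$Z_{\mathsf M}(x)=\sum_{F\in\mathcal L(\mathsf M)}x^{\operatorname{rk}(F)}P_{\mathsf M/F}(x),\qquad Y_{\mathsf M}(x)=\sum_{F\in\mathcal L(\mathsf M)}(-1)^{\operatorname{rk}(\mathsf M)-\operatorname{rk}(F)}\mu(\mathsf M/F)\,x^{\operatorname{rk}(\mathsf M)-\operatorname{rk}(F)}Q_{\mathsf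 M|_F}(x)$$ are palindromic of degree $\operatorname{rk}(\mathsf M)$ for every loopless $\mathsf M$. The polynomial $Y_{\mathsf M}(x)$ is the inverse $Z$-polynomial. If $\mathsf M$ has a loop, put $P_{\mathsf M}=Q_{\mathsf M}=Y_{\mathsf M}=0$. Let $\tau(\mathsf M)$ be the coefficient of $x^{(\operatorname{rk}(\mathsf M)-1)/2}$ in $P_{\mathsf M}(x)$ if $\operatorname{rk}(\mathsf M)$ is odd, and $\tau(\mathsf M)=0$ if $\operatorname{rk}(\mathsf M)$ is even. Let $\mathsf U_{k,n}$ be the uniform matroid of rank $k$ on $n$ elements. **Proposition.** Let $k$ and $n$ be integers with $0<k<n$. Then $$Q_{\mathsf U_{k,n}}(x)=Q_{\mathsf U_{k,n-1}}(x)+(1+x)\,Q_{\mathsf U_{k-1,n-1}}(x)-\tau(\mathsf U_{k-1,n-1})\,x^{k/2},$$ $$Y_{\mathsf U_{k,n}}(x)=Y_{\mathsf U_{k,n-1}}(x)+(1+x)\,Y_{\mathsf U_{k-1,n-1}}(x)-\tau(\mathsf U_{k-1,n-1})\,x^{k/2}.$$ If $k$ is odd, then $\tau(\mathsf U_{k-1,n-1})=0$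 and the last term of each identity is understood to be $0$. -/

import Mathlib

open Polynomial
open scoped Matroid

namespace MatroidKL

/-- The rank of a matroid as a natural number. It is used on finite ground sets only, where
the rank is finite. -/
noncomputable def rk {α : Type*} (M : Matroid α) : ℕ := M.eRank.toNat

/-- The lattice of flats of `M`, ordered by inclusion. -/
abbrev Flat {α : Type*} (M : Matroid α) : Type _ := {F : Set α // M.IsFlat F}

noncomputable instance instFintypeFlat {α : Type*} [Finite α] (M : Matroid α) :
    Fintype (Flat M) := Fintype.ofFinite _

open Classical in
noncomputable instance instLocallyFiniteOrderFlat {α : Type*} [Finite α] (M : Matroid α) :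
    LocallyFiniteOrder (Flat M) := Fintype.toLocallyFiniteOrder

/-- The bottom element of the lattice of flats, the set of loops. It is `∅` if `M` is loopless. -/
def botFlat {α : Type*} (M : Matroid α) : Flat M := ⟨M.loops, M.isFlat_closure ∅⟩

/-- The top element of the lattice of flats, the ground set. -/
def topFlat {α : Type*} (M : Matroid α) : Flat M := ⟨M.E, M.ground_isFlat⟩

open Classical in
/-- The Möbius invariant `μ(M) = μ(∅, E)`: the value of the Möbius function of the lattice of
flats of `M` on the whole lattice. -/
noncomputable def mobius {α : Type*} [Finite α] (M : Matroid α) : ℤ :=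
  IncidenceAlgebra.mu ℤ (botFlat M) (topFlat M)

/-- `f` is palindromic with respect to the degree `d`, that is, `x ^ d * f (1 / x) = f x`. -/
def IsPalindromic (d : ℕ) (f : ℤ[X]) : Prop := f.natDegree ≤ d ∧ f.reflect d = f

/-- `∑_F x ^ rk F * P_{M/F}(x)`, the sum over all flats `F` of `M`. For the Kazhdan–Lusztig
polynomials `P` this is the `Z`-polynomial. -/
noncomputable def zSum {α : Type*} [Finite α] (P : Matroid α → ℤ[X]) (M : Matroid α) : ℤ[X] :=
  ∑ F : Flat M, X ^ rk (M ↾ F.1) * P (M ／ F.1)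

/-- `∑_F (-1) ^ (rk M - rk F) * μ(M/F) * x ^ (rk M - rk F) * Q_{M|F}(x)`, the sum over all
flats `F` of `M`. For the inverse Kazhdan–Lusztig polynomials `Q` this is the inverse
`Z`-polynomial. -/
noncomputable def ySum {α : Type*} [Finite α] (Q : Matroid α → ℤ[X]) (M : Matroid α) : ℤ[X] :=
  ∑ F : Flat M, C ((-1) ^ (rk M - rk (M ↾ F.1)) * mobius (M ／ F.1)) *
    X ^ (rk M - rk (M ↾ F.1)) * Q (M ↾ F.1)

/-- The characterization of a polynomial invariant of loopless matroids by a normalization in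
rank zero, a degree bound, and the palindromicity of a transform `S` of it. The value on a
matroid with loops is `0` by convention. -/
structure IsKLFamily {α : Type*} (S : (Matroid α → ℤ[X]) → Matroid α → ℤ[X])
    (f : Matroid α → ℤ[X]) : Prop where
  of_not_loopless : ∀ M, ¬ M.Loopless → f M = 0
  of_rk_eq_zero : ∀ M, M.Loopless → rk M = 0 → f M = 1
  two_mul_natDegree_lt : ∀ M, M.Loopless → 0 < rk M → 2 * (f M).natDegree < rk M
  isPalindromic : ∀ M, M.Loopless → IsPalindromic (rk M) (S f M)

/-! Existence and uniqueness. -/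

theorem ground_eq_empty {α : Type*} [Finite α] {M : Matroid α} (h : M.Loopless)
    (h0 : rk M = 0) : M.E = ∅ := by
  obtain ⟨B, hB⟩ := M.exists_isBase
  have h1 : B = ∅ := by
    have h2 := hB.encard_eq_eRank
    rw [rk, ← h2] at h0
    exact (Set.ncard_eq_zero (Set.toFinite B)).1 h0
  subst h1
  rw [← hB.closure_eq]
  exact M.loops_eq_empty

theorem rk_restrict_le {α : Type*} [Finite α] (M : Matroid α) (F : Set α) :
    rk (M ↾ F) ≤ rk M := by
  obtain ⟨B, hB⟩ := M.exists_isBase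
  refine ENat.toNat_le_toNat (M.eRk_le_eRank F) ?_
  rw [← hB.encard_eq_eRank]
  exact (Set.toFinite B).encard_lt_top.ne

theorem rk_restrict_add_rk_contract_le {α : Type*} [Finite α] (M : Matroid α) {F : Set α}
    (hF : F ⊆ M.E) : rk (M ↾ F) + rk (M ／ F) ≤ rk M := by
  obtain ⟨I, hI⟩ := M.exists_isBasis F
  obtain ⟨J, hJ⟩ := (M ／ F).exists_isBase
  have hJ1 := (hI.contract_indep_iff).1 hJ.indep
  have h1 : rk (M ↾ F) = I.ncard := by
    rw [rk, Matroid.eRank_restrict, ← hI.encard_eq_eRk]; rfl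
  have h2 : rk (M ／ F) = J.ncard := by
    rw [rk, ← hJ.encard_eq_eRank]; rfl
  obtain ⟨B, hB, hsub⟩ := hJ1.1.exists_isBase_superset
  have h3 : rk M = B.ncard := by
    rw [rk, ← hB.encard_eq_eRank]; rfl
  have hd : Disjoint J I := hJ1.2.symm.mono_right hI.subset
  have h4 : (J ∪ I).ncard = J.ncard + I.ncard := Set.ncard_union_eq hd
  have h5 := Set.ncard_le_ncard hsub (Set.toFinite B)
  omega

theorem palindromic_iff {k : ℕ} (f : ℤ[X]) :
    IsPalindromic k f ↔ f.natDegree ≤ k ∧ ∀ i ≤ k, f.coeff (k - i) = f.coeff i := by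
  refine and_congr_right fun hd => ⟨fun h i hi => ?_, fun h => ?_⟩
  · have := congrArg (fun g => coeff g i) h
    simpa [coeff_reflect, revAt_le hi] using this
  · ext i
    rw [coeff_reflect]
    by_cases hi : i ≤ k
    · rw [revAt_le hi, h i hi]
    · rw [revAt_eq_self_of_lt (by omega)]

/-- The only polynomial of degree less than `k / 2` that makes `R` palindromic when added. -/
noncomputable def completion (k : ℕ) (R : ℤ[X]) : ℤ[X] :=
  ∑ i ∈ Finset.range ((k + 1) / 2), C (R.coeff (k - i) - R.coeff i) * X ^ i

theorem coeff_completion (k : ℕ) (R : ℤ[X]) (i : ℕ) :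
    (completion k R).coeff i = if 2 * i < k then R.coeff (k - i) - R.coeff i else 0 := by
  simp only [completion, finsetSum_coeff, coeff_C_mul_X_pow, Finset.sum_ite_eq,
    Finset.mem_range]
  exact if_congr (by omega) rfl rfl

theorem natDegree_completion {k : ℕ} (hk : 0 < k) (R : ℤ[X]) :
    2 * (completion k R).natDegree < k := by
  by_cases h : completion k R = 0
  · simpa [h] using hk
  · by_contra hc
    have := coeff_completion k R (completion k R).natDegree
    rw [if_neg hc] at this
    exact h (leadingCoeff_eq_zero.1 this)

theorem eq_completion_iff {k : ℕ} {R f : ℤ[X]} (hR : R.natDegree ≤ k)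
    (hf : 2 * f.natDegree < k) : IsPalindromic k (f + R) ↔ f = completion k R := by
  have hz : ∀ i, ¬ 2 * i < k → f.coeff i = 0 := fun i hi =>
    coeff_eq_zero_of_natDegree_lt (by omega)
  rw [palindromic_iff]
  constructor
  · rintro ⟨-, h⟩
    ext i
    rw [coeff_completion]
    split_ifs with hi
    · have := h i (by omega)
      rw [coeff_add, coeff_add, hz (k - i) (by omega)] at this
      linarith
    · exact hz i hi
  · intro h
    refine ⟨(natDegree_add_le _ _).trans (by omega), fun i hi => ?_⟩
    rw [coeff_add, coeff_add, h, coeff_completion, coeff_completion]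
    split_ifs with h1 h2 h2
    · omega
    · rw [Nat.sub_sub_self hi]; ring
    · ring
    · rw [show k - i = i by omega]

theorem existsUnique_isKLFamily {α : Type*} [Finite α]
    (S R : (Matroid α → ℤ[X]) → Matroid α → ℤ[X])
    (hS : ∀ f M, M.Loopless → (rk M = 0 → f M = 1) → S f M = f M + R f M)
    (hR : ∀ f g M, (∀ N : Matroid α, N.E.ncard < M.E.ncard → f N = g N) → R f M = R g M)
    (hR0 : ∀ f M, M.E = ∅ → R f M = 0)
    (hdeg : ∀ f M, (∀ N, (f N).natDegree ≤ rk N) → (R f M).natDegree ≤ rk M) :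
    ∃! f, IsKLFamily S f := by
  classical
  let step : (M : Matroid α) → ((N : Matroid α) → N.E.ncard < M.E.ncard → ℤ[X]) → ℤ[X] :=
    fun M ih => if M.Loopless then if rk M = 0 then 1 else
      completion (rk M) (R (fun N => if h : N.E.ncard < M.E.ncard then ih N h else 0) M) else 0
  have wf : WellFounded fun N M : Matroid α => N.E.ncard < M.E.ncard :=
    (measure fun M : Matroid α => M.E.ncard).wf
  let f : Matroid α → ℤ[X] := wf.fix step
  have hf : ∀ M, f M = if M.Loopless then if rk M = 0 then 1 else
      completion (rk M) (R f M) else 0 := by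
    intro M
    have h1 : f M = step M fun N _ => f N := wf.fix_eq step M
    rw [h1]
    simp only [step]
    rw [hR _ f M fun N hN => dif_pos hN]
  have hfdeg : ∀ N, (f N).natDegree ≤ rk N := by
    intro N
    rw [hf]
    split_ifs with h1 h2
    · simp
    · have := natDegree_completion (Nat.pos_of_ne_zero h2) (R f N)
      omega
    · simp
  refine ⟨f, ⟨fun M hM => by rw [hf, if_neg hM], fun M hM h0 => by rw [hf, if_pos hM, if_pos h0],
    fun M hM h0 => ?_, fun M hM => ?_⟩, fun g hg => ?_⟩
  · rw [hf, if_pos hM, if_neg h0.ne']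
    exact natDegree_completion h0 _
  · have hM1 : rk M = 0 → f M = 1 := fun h0 => by rw [hf, if_pos hM, if_pos h0]
    rw [hS f M hM hM1]
    by_cases h0 : rk M = 0
    · rw [hR0 f M (ground_eq_empty hM h0), hM1 h0, h0, palindromic_iff]
      exact ⟨by simp, fun i hi => by rw [Nat.le_zero.1 hi]⟩
    · have hfM : f M = completion (rk M) (R f M) := by rw [hf, if_pos hM, if_neg h0]
      refine (eq_completion_iff (hdeg f M hfdeg) ?_).2 hfM
      rw [hfM]
      exact natDegree_completion (Nat.pos_of_ne_zero h0) _
  · have hgdeg : ∀ N, (g N).natDegree ≤ rk N := by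
      intro N
      by_cases hN : N.Loopless
      · by_cases h0 : rk N = 0
        · rw [hg.of_rk_eq_zero N hN h0]; simp
        · have := hg.two_mul_natDegree_lt N hN (Nat.pos_of_ne_zero h0)
          omega
      · rw [hg.of_not_loopless N hN]; simp
    funext M
    induction M using wf.induction with
    | _ M ih =>
      rw [hf]
      split_ifs with h1 h2
      · exact hg.of_rk_eq_zero M h1 h2
      · rw [← hR g f M ih]
        refine (eq_completion_iff (hdeg g M hgdeg)
          (hg.two_mul_natDegree_lt M h1 (Nat.pos_of_ne_zero h2))).1 ?_
        rw [← hS g M h1 (hg.of_rk_eq_zero M h1)]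
        exact hg.isPalindromic M h1
      · exact hg.of_not_loopless M h1

theorem ncard_contract_lt {α : Type*} [Finite α] (M : Matroid α) {F : Set α} (hF : F ⊆ M.E)
    (hne : F ≠ ∅) : (M ／ F).E.ncard < M.E.ncard := by
  refine Set.ncard_lt_ncard ?_ (Set.toFinite _)
  rw [Matroid.contract_ground]
  obtain ⟨x, hx⟩ := Set.nonempty_iff_ne_empty.2 hne
  exact ⟨Set.sdiff_subset, fun h => (h (hF hx)).2 hx⟩

theorem rk_restrict_empty {α : Type*} (M : Matroid α) : rk (M ↾ ∅) = 0 := by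
  rw [rk, Matroid.eRank_restrict, Matroid.eRk_empty]; rfl

theorem mobius_of_ground_eq_empty {α : Type*} [Finite α] (M : Matroid α) (h : M.E = ∅) :
    mobius M = 1 := by
  have h1 : botFlat M = topFlat M :=
    Subtype.ext ((Set.subset_empty_iff.1 (h ▸ (botFlat M).2.subset_ground)).trans h.symm)
  rw [mobius, h1, IncidenceAlgebra.mu_self]

/-- There is exactly one family of polynomials with the defining properties of the
Kazhdan–Lusztig polynomials. -/
theorem existsUnique_kl (α : Type*) [Finite α] :
    ∃! P : Matroid α → ℤ[X], IsKLFamily zSum P := by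
  classical
  refine existsUnique_isKLFamily zSum
    (fun f M => ∑ F : Flat M with F.1 ≠ ∅, X ^ rk (M ↾ F.1) * f (M ／ F.1)) ?_ ?_ ?_ ?_
  · intro f M hM _
    have h0 : M.IsFlat ∅ := by
      rw [← M.loops_eq_empty]; exact M.isFlat_closure ∅
    rw [zSum, ← Finset.sum_filter_add_sum_filter_not Finset.univ (fun F : Flat M => F.1 = ∅)]
    congr 1
    rw [Finset.sum_eq_single_of_mem (⟨∅, h0⟩ : Flat M) (by simp)]
    · change X ^ rk (M ↾ ∅) * f (M ／ ∅) = f M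
      rw [rk_restrict_empty, Matroid.contract_empty, pow_zero, one_mul]
    · intro F hF hne
      exact absurd (Subtype.ext (Finset.mem_filter.1 hF).2) hne
  · intro f g M h
    refine Finset.sum_congr rfl fun F hF => ?_
    rw [h _ (ncard_contract_lt M F.2.subset_ground (Finset.mem_filter.1 hF).2)]
  · intro f M hM
    refine Finset.sum_eq_zero fun F hF => ?_
    exact absurd (Set.subset_empty_iff.1 (hM ▸ F.2.subset_ground)) (Finset.mem_filter.1 hF).2
  · intro f M h
    refine natDegree_sum_le_of_forall_le _ _ fun F _ => ?_
    have h1 := rk_restrict_add_rk_contract_le M F.2.subset_ground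
    have h2 := h (M ／ F.1)
    refine natDegree_mul_le.trans ?_
    rw [natDegree_X_pow]
    omega

/-- There is exactly one family of polynomials with the defining properties of the inverse
Kazhdan–Lusztig polynomials. -/
theorem existsUnique_invKL (α : Type*) [Finite α] :
    ∃! Q : Matroid α → ℤ[X], IsKLFamily ySum Q := by
  classical
  refine existsUnique_isKLFamily ySum
    (fun f M => ∑ F : Flat M with F.1 ≠ M.E, C ((-1) ^ (rk M - rk (M ↾ F.1)) * mobius (M ／ F.1)) *
      X ^ (rk M - rk (M ↾ F.1)) * f (M ↾ F.1)) ?_ ?_ ?_ ?_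
  · intro f M hM _
    rw [ySum, ← Finset.sum_filter_add_sum_filter_not Finset.univ (fun F : Flat M => F.1 = M.E)]
    congr 1
    rw [Finset.sum_eq_single_of_mem (topFlat M) (by simp [topFlat])]
    · simp [topFlat, mobius_of_ground_eq_empty (M ／ M.E) (by simp)]
    · intro F hF hne
      exact absurd (Subtype.ext (Finset.mem_filter.1 hF).2) hne
  · intro f g M h
    refine Finset.sum_congr rfl fun F hF => ?_
    rw [h _ (Set.ncard_lt_ncard (F.2.subset_ground.ssubset_of_ne (Finset.mem_filter.1 hF).2)
      (Set.toFinite _))]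
  · intro f M hM
    refine Finset.sum_eq_zero fun F hF => ?_
    exact absurd ((Set.subset_empty_iff.1 (hM ▸ F.2.subset_ground)).trans hM.symm)
      (Finset.mem_filter.1 hF).2
  · intro f M h
    refine natDegree_sum_le_of_forall_le _ _ fun F _ => ?_
    have h1 := rk_restrict_le M F.1
    have h2 := h (M ↾ F.1)
    refine natDegree_mul_le.trans ?_
    have h3 := natDegree_C_mul_X_pow_le
      ((-1) ^ (rk M - rk (M ↾ F.1)) * mobius (M ／ F.1)) (rk M - rk (M ↾ F.1))
    omega

/-! The invariants. -/

/-- The Kazhdan–Lusztig polynomial `P_M`. -/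
noncomputable def kl {α : Type*} [Finite α] (M : Matroid α) : ℤ[X] :=
  (existsUnique_kl α).choose M

/-- The inverse Kazhdan–Lusztig polynomial `Q_M`. -/
noncomputable def invKL {α : Type*} [Finite α] (M : Matroid α) : ℤ[X] :=
  (existsUnique_invKL α).choose M

/-- The inverse `Z`-polynomial `Y_M`. It vanishes, as `Q_M` does, if `M` has a loop. -/
noncomputable def invZ {α : Type*} [Finite α] (M : Matroid α) : ℤ[X] := ySum invKL M

theorem isKLFamily_kl (α : Type*) [Finite α] :
    IsKLFamily zSum (kl : Matroid α → ℤ[X]) := (existsUnique_kl α).choose_spec.1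

theorem isKLFamily_invKL (α : Type*) [Finite α] :
    IsKLFamily ySum (invKL : Matroid α → ℤ[X]) := (existsUnique_invKL α).choose_spec.1

/-- `τ(M)`: the coefficient of `x ^ ((rk M - 1) / 2)` in `P_M` if the rank is odd, else `0`. -/
noncomputable def tau {α : Type*} [Finite α] (M : Matroid α) : ℤ :=
  if Odd (rk M) then (kl M).coeff ((rk M - 1) / 2) else 0

/-- The uniform matroid `U_{k,n}` on the ground set `Fin n`: the independent sets are the sets
with at most `k` elements. Its rank is `k` if `k ≤ n`. -/
def uniform (k n : ℕ) : Matroid (Fin n) :=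
  (IndepMatroid.ofFinite (E := Set.univ) Set.finite_univ (fun I => I.ncard ≤ k)
    (by simp)
    (fun _ J hJ hIJ => (Set.ncard_le_ncard hIJ (Set.toFinite J)).trans hJ)
    (fun I J hI hJ h => by
      obtain ⟨e, he, heI⟩ := Set.exists_mem_notMem_of_ncard_lt_ncard h (Set.toFinite I)
      refine ⟨e, he, heI, ?_⟩
      rw [Set.ncard_insert_of_notMem heI (Set.toFinite I)]
      omega)
    (fun I _ => Set.subset_univ I)).matroid

end MatroidKL

namespace MatroidKL

/-! The flats of `U_{k,n}` are the ground set and all sets with fewer than `k` elements.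
Restrictions to the latter are Boolean matroids, whose inverse Kazhdan–Lusztig polynomial is 1.
Hence `Y = Q + T`, where `T = unifTail k n` is an explicit sum of binomial coefficients, and for `k
> 0` the polynomial `Q` is the unique low-degree completion of `T` to a palindromic polynomial.

Pascal's rule gives `T_{k,n} = T_{k,n-1} + (1+x) T_{k-1,n-1}` (`unifTail_succ_succ`). So the defect
of this recurrence is the same for `Q` as for `Y`. On the `Y` side it is palindromic of degree `k`;
on the `Q` side its degree is at most `k/2`. It is therefore a multiple of `x^(k/2)`, and for even
`k` the factor is minus the coefficient of `x^((k-2)/2)` in `Q_{k-1,n-1}` (`unifInvKL_succ_succ`).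

It remains to see that this coefficient is `τ`, that is, that `P` and `Q` have the same coefficient
at `x^((r-1)/2)` in odd rank `r`. This follows from the formula of `unifKL`, which writes `P` as a
signed sum of polynomials `Q` of contractions. Its validity rests on `isPalindromic_unifKL` and the
uniqueness of completions. -/

/-! ### Binomial sums and the tail of the inverse Z-polynomial. -/

/-- Truncated composition law for binomial transforms: collect the terms with `j + l = m` and expand
`(u + v) ^ m`. -/
theorem sum_range_choose_mul_sum_range_choose {R : Type*} [CommRing R] (n k : ℕ) (u v : R)
    (f : ℕ → R) :
    ∑ j ∈ Finset.range k, (n.choose j : R) * u ^ j *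
        ∑ l ∈ Finset.range (k - j), ((n - j).choose l : R) * v ^ l * f (j + l) =
      ∑ m ∈ Finset.range k, (n.choose m : R) * (u + v) ^ m * f m := by
  simp_rw [add_pow, Finset.mul_sum, Finset.sum_mul]
  rw [Finset.sum_sigma', Finset.sum_sigma']
  refine Finset.sum_bij' (fun p _ => ⟨p.1 + p.2, p.1⟩) (fun p _ => ⟨p.2, p.1 - p.2⟩)
    ?_ ?_ ?_ ?_ ?_
  · rintro ⟨j, l⟩ h
    simp only [Finset.mem_sigma, Finset.mem_range] at h ⊢
    omega
  · rintro ⟨m, j⟩ h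
    simp only [Finset.mem_sigma, Finset.mem_range] at h ⊢
    omega
  · rintro ⟨j, l⟩ h
    simp
  · rintro ⟨m, j⟩ h
    simp only [Finset.mem_sigma, Finset.mem_range] at h
    simp [Nat.add_sub_cancel' (show j ≤ m by omega)]
  · rintro ⟨j, l⟩ h
    simp only [Nat.add_sub_cancel_left]
    have h1 : (n.choose (j + l) : R) * ((j + l).choose j : R) =
        (n.choose j : R) * ((n - j).choose l : R) := by
      have := Nat.choose_mul (n := n) (k := j + l) (s := j) (by omega)
      rw [Nat.add_sub_cancel_left] at this
      rw [← Nat.cast_mul, this, Nat.cast_mul]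
    linear_combination (-(u ^ j * v ^ l * f (j + l))) * h1

/-- The contribution of the proper flats to the inverse `Z`-polynomial of the uniform matroid of
rank `k` on `n` elements. -/
noncomputable def unifTail (k n : ℕ) : ℤ[X] :=
  ∑ j ∈ Finset.range k, (n.choose j : ℤ[X]) * (((n - j - 1).choose (k - j - 1) : ℤ[X]) * X ^ (k - j))

theorem unifTail_zero (n : ℕ) : unifTail 0 n = 0 := by simp [unifTail]

theorem natDegree_unifTail_le (k n : ℕ) : (unifTail k n).natDegree ≤ k := by
  refine natDegree_sum_le_of_forall_le _ _ fun j _ => ?_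
  rw [← mul_assoc, ← Nat.cast_mul]
  refine natDegree_mul_le.trans ?_
  rw [natDegree_natCast, natDegree_X_pow]
  omega

/-- Pascal's rule is used twice: on the Möbius factor, which merges `unifTail (k + 1) n` with `X *
unifTail k n`, and then on the number of flats, which absorbs the remaining `unifTail k n` after an
index shift. -/
theorem unifTail_succ_succ {k n : ℕ} (h : k + 1 ≤ n) :
    unifTail (k + 1) (n + 1) = unifTail (k + 1) n + (1 + X) * unifTail k n := by
  have h1 : unifTail (k + 1) n + X * unifTail k n =
      ∑ j ∈ Finset.range (k + 1), (n.choose j : ℤ[X]) * (((n - j).choose (k - j) : ℤ[X]) *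
        X ^ (k + 1 - j)) := by
    rw [unifTail, unifTail, Finset.sum_range_succ, Finset.sum_range_succ, Finset.mul_sum,
      add_right_comm, ← Finset.sum_add_distrib]
    congr 1
    · refine Finset.sum_congr rfl fun j hj => ?_
      rw [Finset.mem_range] at hj
      obtain ⟨a, rfl⟩ : ∃ a, k = j + a + 1 := ⟨k - j - 1, by omega⟩
      obtain ⟨b, rfl⟩ : ∃ b, n = j + b + 1 := ⟨n - j - 1, by omega⟩
      rw [show j + a + 1 + 1 - j - 1 = a + 1 by omega, show j + b + 1 - j - 1 = b by omega,
        show j + a + 1 - j - 1 = a by omega, show j + a + 1 + 1 - j = a + 2 by omega,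
        show j + b + 1 - j = b + 1 by omega, show j + a + 1 - j = a + 1 by omega,
        Nat.choose_succ_succ b a]
      push_cast
      ring
    · simp
  rw [add_mul, one_mul, add_comm (unifTail k n), ← add_assoc, h1, unifTail,
    Finset.sum_range_succ', Finset.sum_range_succ', unifTail, add_right_comm,
    ← Finset.sum_add_distrib]
  congr 1
  · refine Finset.sum_congr rfl fun j hj => ?_
    rw [show n + 1 - (j + 1) - 1 = n - j - 1 by omega, show k + 1 - (j + 1) - 1 = k - j - 1 by omega,
      show k + 1 - (j + 1) = k - j by omega, Nat.choose_succ_succ n j,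
      show n - (j + 1) = n - j - 1 by omega, show k - (j + 1) = k - j - 1 by omega]
    push_cast
    ring
  · simp

theorem one_add_unifTail_self (k : ℕ) : 1 + unifTail k k = (1 + X) ^ k := by
  rw [add_pow, Finset.sum_range_succ, unifTail, add_comm]
  congr 1
  · refine Finset.sum_congr rfl fun j _ => ?_
    simp
    ring
  · simp

/-- At `-1` the factor `1 + X` of the recurrence vanishes, so the value does not depend on `n` and
can be read off from `n = k`. -/
theorem eval_neg_one_unifTail {k n : ℕ} (hk : 0 < k) (hkn : k ≤ n) :
    (unifTail k n).eval (-1) = -1 := by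
  induction n, hkn using Nat.le_induction with
  | base =>
    have := congrArg (eval (-1)) (one_add_unifTail_self k)
    simp [hk.ne'] at this
    linarith
  | succ n h ih =>
    obtain ⟨k, rfl⟩ : ∃ l, k = l + 1 := ⟨k - 1, by omega⟩
    simp [unifTail_succ_succ h, ih]

/-! ### Palindromic polynomials. -/

theorem isPalindromic_one_add_X_pow_mul {d : ℕ} {f : ℤ[X]} (hf : IsPalindromic d f) (m : ℕ) :
    IsPalindromic (m + d) ((1 + X) ^ m * f) := by
  induction m with
  | zero => simpa using hf
  | succ m ih =>
    have h1 : ((1 : ℤ[X]) + X).natDegree ≤ 1 := by compute_degree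
    have h2 : ((1 : ℤ[X]) + X).reflect 1 = 1 + X := by
      rw [reflect_add, ← C_1, reflect_C, ← pow_one (X : ℤ[X]), reflect_monomial]
      simp [add_comm]
    rw [pow_succ', mul_assoc, show m + 1 + d = 1 + (m + d) by omega]
    exact ⟨natDegree_mul_le.trans (add_le_add h1 ih.1), by rw [reflect_mul _ _ h1 ih.1, h2, ih.2]⟩

theorem IsPalindromic.add {d : ℕ} {f g : ℤ[X]} (hf : IsPalindromic d f)
    (hg : IsPalindromic d g) : IsPalindromic d (f + g) :=
  ⟨(natDegree_add_le _ _).trans (max_le hf.1 hg.1), by rw [reflect_add, hf.2, hg.2]⟩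

theorem IsPalindromic.C_mul {d : ℕ} {f : ℤ[X]} (hf : IsPalindromic d f) (a : ℤ) :
    IsPalindromic d (C a * f) :=
  ⟨(natDegree_C_mul_le _ _).trans hf.1, by rw [reflect_C_mul, hf.2]⟩

theorem IsPalindromic.sub {d : ℕ} {f g : ℤ[X]} (hf : IsPalindromic d f)
    (hg : IsPalindromic d g) : IsPalindromic d (f - g) := by
  simpa [sub_eq_add_neg] using hf.add (hg.C_mul (-1))

theorem isPalindromic_zero (d : ℕ) : IsPalindromic d 0 := by simp [IsPalindromic]

theorem isPalindromic_sum {ι : Type*} (s : Finset ι) {d : ℕ} {f : ι → ℤ[X]}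
    (hf : ∀ i ∈ s, IsPalindromic d (f i)) : IsPalindromic d (∑ i ∈ s, f i) :=
  Finset.sum_induction f _ (fun _ _ => IsPalindromic.add) (isPalindromic_zero d) hf

/-- A palindromic polynomial whose degree is at most half of the nominal degree is a monomial. -/
theorem IsPalindromic.eq_C_mul_X_pow {d : ℕ} {f : ℤ[X]} (hf : IsPalindromic d f)
    (h : 2 * f.natDegree ≤ d) : f = C (if Even d then f.coeff (d / 2) else 0) * X ^ (d / 2) := by
  have h1 := ((palindromic_iff f).1 hf).2
  have h2 : ∀ i, 2 * i ≠ d → f.coeff i = 0 := by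
    intro i hi
    rcases lt_or_gt_of_ne hi with h3 | h3
    · rw [← h1 i (by omega)]
      exact coeff_eq_zero_of_natDegree_lt (by omega)
    · exact coeff_eq_zero_of_natDegree_lt (by omega)
  ext i
  rw [coeff_C_mul_X_pow]
  split_ifs with h3 h4
  · rw [h3]
  · exact h2 i fun h5 => h4 ⟨i, by omega⟩
  · exact h2 i fun h5 => h3 (by omega)

/-! ### Closed forms for the uniform matroids. -/

/-- The inverse Kazhdan–Lusztig polynomial of the uniform matroid of rank `k` on `n` elements. -/
noncomputable def unifInvKL (k n : ℕ) : ℤ[X] := completion k (unifTail k n)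

/-- The Kazhdan–Lusztig polynomial of the uniform matroid of rank `k` on `n` elements. -/
noncomputable def unifKL (k n : ℕ) : ℤ[X] :=
  ∑ j ∈ Finset.range k, C ((-1) ^ (k - 1)) * ((n.choose j : ℤ[X]) * (-1) ^ j *
    unifInvKL (k - j) (n - j))

theorem isPalindromic_unifInvKL_add_unifTail (k n : ℕ) :
    IsPalindromic k (unifInvKL k n + unifTail k n) := by
  rcases Nat.eq_zero_or_pos k with rfl | hk
  · simpa [unifInvKL, completion, unifTail_zero] using isPalindromic_zero 0
  · exact (eq_completion_iff (natDegree_unifTail_le k n) (natDegree_completion hk _)).2 rfl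

/-- Composing with parameters `-(1 + X)` and `1` leaves powers of `-X`. Every term is then an
integer times `X ^ k`, and the integers add up to `(-1) ^ k` times the value of the tail at `-1`. -/
theorem sum_range_choose_mul_unifTail {k n : ℕ} (hk : 0 < k) (hkn : k ≤ n) :
    ∑ m ∈ Finset.range k, (n.choose m : ℤ[X]) * (-(1 + X) : ℤ[X]) ^ m * unifTail (k - m) (n - m) =
      (-1) ^ (k - 1) * X ^ k := by
  have h1 := sum_range_choose_mul_sum_range_choose n k (-(1 + X) : ℤ[X]) 1
    (fun s => ((n - s - 1).choose (k - s - 1) : ℤ[X]) * X ^ (k - s))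
  simp only [one_pow, mul_one] at h1
  simp only [unifTail, Nat.sub_sub] at h1 ⊢
  rw [h1]
  have h2 := eval_neg_one_unifTail hk hkn
  obtain ⟨k, rfl⟩ : ∃ l, k = l + 1 := ⟨k - 1, by omega⟩
  -- The constant `-1` is isolated so that it can be replaced by the value of the tail at `-1`.
  rw [show (-1 : ℤ[X]) ^ (k + 1 - 1) * X ^ (k + 1) = (-1) ^ (k + 1) * X ^ (k + 1) * C (-1) by
    rw [Nat.add_sub_cancel, C_neg, C_1]; ring, ← h2, unifTail]
  simp only [eval_finsetSum, map_sum, eval_mul, eval_natCast, eval_pow, eval_X,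
    map_mul, map_pow, map_neg, map_one, map_natCast, Nat.sub_sub]
  rw [Finset.mul_sum]
  refine Finset.sum_congr rfl fun j hj => ?_
  rw [Finset.mem_range] at hj
  obtain ⟨a, rfl⟩ : ∃ a, k = j + a := ⟨k - j, by omega⟩
  rw [show j + a + 1 - j = a + 1 by omega]
  have h5 : (-1 : ℤ[X]) ^ (a + 1) * (-1) ^ (a + 1) = 1 := by
    rw [← mul_pow]; simp
  rw [show (-(1 + X) + 1 : ℤ[X]) = -1 * X by ring, mul_pow, add_assoc, pow_add (-1 : ℤ[X]),
    pow_add X j]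
  linear_combination (-((n.choose j : ℤ[X]) * ((n - (j + 1)).choose (j + (a + 1) - (j + 1)) : ℤ[X]) *
    (-1) ^ j * X ^ j * X ^ (a + 1))) * h5

/-- Composition with parameters `-X` and `-1` turns the sum over `unifKL` into a sum over
`unifInvKL` with weights `(-(1 + X)) ^ m`. By `sum_range_choose_mul_unifTail` the term `X ^ k` is
the same sum over `unifTail`. Together they form a combination of `(1 + X) ^ m` times palindromic
polynomials of degree `k - m`. -/
theorem isPalindromic_unifKL {k n : ℕ} (hk : 0 < k) (hkn : k ≤ n) :
    IsPalindromic k (X ^ k + ∑ j ∈ Finset.range k, (n.choose j : ℤ[X]) *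
      (X ^ j * unifKL (k - j) (n - j))) := by
  have h1 := sum_range_choose_mul_sum_range_choose n k (-X : ℤ[X]) (-1)
    (fun s => unifInvKL (k - s) (n - s))
  have h2 : ∑ j ∈ Finset.range k, (n.choose j : ℤ[X]) * (X ^ j * unifKL (k - j) (n - j)) =
      C ((-1) ^ (k - 1)) * ∑ m ∈ Finset.range k, (n.choose m : ℤ[X]) * (-(1 + X) : ℤ[X]) ^ m *
        unifInvKL (k - m) (n - m) := by
    rw [show (-(1 + X) : ℤ[X]) = -X + -1 by ring, ← h1, Finset.mul_sum]
    refine Finset.sum_congr rfl fun j hj => ?_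
    rw [Finset.mem_range] at hj
    simp only [unifKL, ← Finset.mul_sum, Nat.sub_sub]
    obtain ⟨a, rfl⟩ : ∃ a, k = j + a + 1 := ⟨k - j - 1, by omega⟩
    rw [show j + a + 1 - (j + 1) = a by omega, show j + a + 1 - 1 = j + a by omega, neg_pow (X : ℤ[X]) j]
    simp only [C_pow, C_neg, C_1]
    have h5 : (-1 : ℤ[X]) ^ j * (-1) ^ j = 1 := by
      rw [← mul_pow]; simp
    rw [pow_add]
    generalize (∑ l ∈ Finset.range (j + a + 1 - j), (_ : ℤ[X])) = T
    linear_combination (-((n.choose j : ℤ[X]) * X ^ j * (-1) ^ a * T)) * h5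
  have h3 : X ^ k + ∑ j ∈ Finset.range k, (n.choose j : ℤ[X]) *
      (X ^ j * unifKL (k - j) (n - j)) =
      ∑ m ∈ Finset.range k, C ((-1) ^ (k - 1) * ((n.choose m : ℤ) * (-1) ^ m)) *
        ((1 + X) ^ m * (unifInvKL (k - m) (n - m) + unifTail (k - m) (n - m))) := by
    have h4 := sum_range_choose_mul_unifTail hk hkn
    have h5 : (-1 : ℤ[X]) ^ (k - 1) * (-1) ^ (k - 1) = 1 := by
      rw [← mul_pow]; simp
    have h6 : (X ^ k : ℤ[X]) = C ((-1) ^ (k - 1)) * ∑ m ∈ Finset.range k,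
        (n.choose m : ℤ[X]) * (-(1 + X) : ℤ[X]) ^ m * unifTail (k - m) (n - m) := by
      rw [h4, ← mul_assoc]
      simp [h5]
    rw [h2, h6, ← mul_add, ← Finset.sum_add_distrib, Finset.mul_sum]
    refine Finset.sum_congr rfl fun m _ => ?_
    rw [neg_pow (1 + X : ℤ[X])]
    simp only [map_mul, map_pow, map_neg, map_one, map_natCast]
    ring
  rw [h3]
  refine isPalindromic_sum _ fun m hm => IsPalindromic.C_mul ?_ _
  have h7 := isPalindromic_one_add_X_pow_mul
    (isPalindromic_unifInvKL_add_unifTail (k - m) (n - m)) m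
  rwa [Nat.add_sub_cancel' (Finset.mem_range.1 hm).le] at h7

theorem coeff_unifKL (k n i : ℕ) : (unifKL k n).coeff i = ∑ j ∈ Finset.range k,
    (-1) ^ (k - 1) * ((n.choose j : ℤ) * (-1) ^ j) * (unifInvKL (k - j) (n - j)).coeff i := by
  rw [unifKL, finsetSum_coeff]
  refine Finset.sum_congr rfl fun j _ => ?_
  rw [← coeff_C_mul, map_mul, map_mul, mul_assoc (C _)]
  simp

theorem natDegree_unifKL {k : ℕ} (hk : 0 < k) (n : ℕ) : 2 * (unifKL k n).natDegree < k := by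
  suffices h : (unifKL k n).natDegree ≤ (k - 1) / 2 by omega
  rw [natDegree_le_iff_coeff_eq_zero]
  intro i hi
  rw [coeff_unifKL]
  refine Finset.sum_eq_zero fun j _ => ?_
  rw [unifInvKL, coeff_completion, if_neg (by omega), mul_zero]

/-- Only the summand `j = 0` reaches this degree; the others come from smaller rank. -/
theorem coeff_unifKL_of_odd {k : ℕ} (hk : Odd k) (n : ℕ) :
    (unifKL k n).coeff ((k - 1) / 2) = (unifInvKL k n).coeff ((k - 1) / 2) := by
  obtain ⟨a, rfl⟩ := hk
  rw [coeff_unifKL, Finset.sum_range_succ', Finset.sum_eq_zero, zero_add]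
  · simp
  · intro j _
    rw [unifInvKL, coeff_completion, if_neg (by omega), mul_zero]

/-! ### Uniform matroids on arbitrary ground sets, a class that contains the minors needed. -/

/-- `M` is a uniform matroid of rank `k` on its ground set. -/
structure IsUniform {α : Type*} (M : Matroid α) (k : ℕ) : Prop where
  indep_iff : ∀ I, M.Indep I ↔ I ⊆ M.E ∧ I.ncard ≤ k
  le_ncard : k ≤ M.E.ncard

variable {α : Type*} {M : Matroid α} {k : ℕ} {F : Set α}

theorem IsUniform.isFlat (hM : IsUniform M k) (hF : F ⊆ M.E) (h : F.ncard < k) :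
    M.IsFlat F := by
  have hI := (hM.indep_iff F).2 ⟨hF, h.le⟩
  refine Matroid.isFlat_iff_closure_eq.2 (Set.Subset.antisymm (fun x hx => ?_)
    (M.subset_closure F))
  rw [hI.mem_closure_iff'] at hx
  exact hx.2 ((hM.indep_iff _).2 ⟨Set.insert_subset hx.1 hF, (Set.ncard_insert_le x F).trans h⟩)

theorem loopless_of_ground_eq_empty (h : M.E = ∅) : M.Loopless :=
  ⟨Set.subset_empty_iff.1 (h ▸ M.loops_subset_ground)⟩

theorem IsUniform.loopless (hM : IsUniform M k) (h : 0 < k ∨ M.E = ∅) : M.Loopless := by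
  rcases h with h | h
  · constructor
    exact (hM.isFlat (Set.empty_subset _) (by simpa using h)).closure
  · exact loopless_of_ground_eq_empty h

variable [Finite α]

theorem IsUniform.isBase (hM : IsUniform M k) (hF : F ⊆ M.E) (h : F.ncard = k) : M.IsBase F := by
  refine ((hM.indep_iff F).2 ⟨hF, h.le⟩).isBase_of_maximal fun J hJ hFJ => ?_
  exact Set.eq_of_subset_of_ncard_le hFJ (((hM.indep_iff J).1 hJ).2.trans h.ge) (Set.toFinite J)

theorem IsUniform.rk_eq (hM : IsUniform M k) : rk M = k := by
  obtain ⟨B, hB, h⟩ := Set.exists_subset_card_eq hM.le_ncard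
  rw [rk, ← (hM.isBase hB h).encard_eq_eRank]
  exact h

/-- A flat with at least `k` elements contains a base, hence is the whole ground set. -/
theorem IsUniform.ncard_lt_of_isFlat (hM : IsUniform M k) (hF : M.IsFlat F) (h : F ≠ M.E) :
    F.ncard < k := by
  by_contra! hc
  obtain ⟨B, hB, h1⟩ := Set.exists_subset_card_eq hc
  refine h (hF.subset_ground.antisymm ?_)
  rw [← (hM.isBase (hB.trans hF.subset_ground) h1).closure_eq]
  exact (M.closure_subset_closure hB).trans hF.closure.subset

theorem IsUniform.contract (hM : IsUniform M k) (hF : F ⊆ M.E) (h : F.ncard ≤ k) :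
    IsUniform (M ／ F) (k - F.ncard) where
  indep_iff I := by
    rw [((hM.indep_iff F).2 ⟨hF, h⟩).contract_indep_iff, hM.indep_iff, Matroid.contract_ground,
      Set.subset_sdiff]
    constructor
    · rintro ⟨h1, h2, h3⟩
      rw [Set.ncard_union_eq h1] at h3
      exact ⟨⟨Set.subset_union_left.trans h2, h1⟩, by omega⟩
    · rintro ⟨⟨h1, h2⟩, h3⟩
      refine ⟨h2, Set.union_subset h1 hF, ?_⟩
      rw [Set.ncard_union_eq h2]
      omega
  le_ncard := by
    rw [Matroid.contract_ground, Set.ncard_sdiff hF]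
    have := hM.le_ncard
    omega

theorem ncard_ground_contract (hF : F ⊆ M.E) : (M ／ F).E.ncard = M.E.ncard - F.ncard := by
  rw [Matroid.contract_ground, Set.ncard_sdiff hF]

theorem IsUniform.restrict (hM : IsUniform M k) (hF : F ⊆ M.E) (h : F.ncard ≤ k) :
    IsUniform (M ↾ F) F.ncard where
  indep_iff I := by
    rw [Matroid.restrict_indep_iff, hM.indep_iff, Matroid.restrict_ground_eq]
    exact ⟨fun h1 => ⟨h1.2, Set.ncard_le_ncard h1.2⟩,
      fun h1 => ⟨⟨h1.1.trans hF, h1.2.trans h⟩, h1.1⟩⟩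
  le_ncard := le_rfl

theorem rk_of_ground_eq_empty (h : M.E = ∅) : rk M = 0 := by
  have : IsUniform M 0 := by
    refine ⟨fun I => ⟨fun hI => ⟨hI.subset_ground, ?_⟩, fun hI => ?_⟩, by simp⟩
    · simp [Set.subset_empty_iff.1 (hI.subset_ground.trans h.subset)]
    · rw [Set.subset_empty_iff.1 (hI.1.trans h.subset)]
      exact M.empty_indep
  exact this.rk_eq

theorem kl_of_ground_eq_empty (h : M.E = ∅) : kl M = 1 :=
  (isKLFamily_kl α).of_rk_eq_zero M (loopless_of_ground_eq_empty h) (rk_of_ground_eq_empty h)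

theorem invKL_of_ground_eq_empty (h : M.E = ∅) : invKL M = 1 :=
  (isKLFamily_invKL α).of_rk_eq_zero M (loopless_of_ground_eq_empty h) (rk_of_ground_eq_empty h)

theorem ncard_setOf_subset_ncard_eq (s : Set α) (j : ℕ) :
    {F : Set α | F ⊆ s ∧ F.ncard = j}.ncard = s.ncard.choose j := by
  classical
  rw [Set.ncard_eq_toFinset_card s s.toFinite, ← Finset.card_powersetCard, ← Set.ncard_coe_finset]
  refine Set.ncard_congr (fun F _ => F.toFinite.toFinset) ?_ ?_ ?_
  · rintro F ⟨h1, h2⟩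
    rw [Finset.mem_coe, Finset.mem_powersetCard, Set.Finite.toFinset_subset_toFinset,
      ← Set.ncard_eq_toFinset_card]
    exact ⟨h1, h2⟩
  · intro F F' _ _ h
    exact Set.Finite.toFinset_inj.1 h
  · intro S hS
    rw [Finset.mem_coe, Finset.mem_powersetCard, Set.Finite.subset_toFinset] at hS
    exact ⟨S, ⟨hS.1, (Set.ncard_coe_finset S).trans hS.2⟩, by simp⟩

/-! ### Flats and the Möbius function of uniform matroids. -/

/-- Sums over the lattice of flats of a uniform matroid. -/
theorem IsUniform.sum_flat {A : Type*} [CommSemiring A] (hM : IsUniform M k) (g : Flat M → A)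
    (f : ℕ → A) (h : ∀ F : Flat M, F.1.ncard < k → g F = f F.1.ncard) :
    ∑ F, g F = g (topFlat M) + ∑ j ∈ Finset.range k, (M.E.ncard.choose j : A) * f j := by
  classical
  rw [← Finset.add_sum_erase _ g (Finset.mem_univ (topFlat M))]
  have hlt : ∀ F ∈ Finset.univ.erase (topFlat M), F.1.ncard < k := fun F hF =>
    hM.ncard_lt_of_isFlat F.2 fun h1 => Finset.ne_of_mem_erase hF (Subtype.ext h1)
  rw [← Finset.sum_fiberwise_of_maps_to (s := Finset.univ.erase (topFlat M))
    (t := Finset.range k) (g := fun F : Flat M => F.1.ncard)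
    fun F hF => Finset.mem_range.2 (hlt F hF)]
  congr 1
  refine Finset.sum_congr rfl fun j hj => ?_
  rw [Finset.sum_congr rfl (g := fun _ => f j), Finset.sum_const, nsmul_eq_mul,
    ← ncard_setOf_subset_ncard_eq, ← Set.ncard_coe_finset]
  · congr 2
    refine Set.ncard_congr (fun F _ => F.1) ?_ (fun _ _ _ _ => Subtype.ext) ?_
    · intro F hF
      simp only [Finset.coe_filter, Set.mem_ofPred_eq] at hF
      exact ⟨F.2.subset_ground, hF.2⟩
    · rintro F ⟨hF, h1⟩
      have h2 : F.ncard < k := h1 ▸ Finset.mem_range.1 hj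
      refine ⟨⟨F, hM.isFlat hF h2⟩, ?_, rfl⟩
      simp only [Finset.coe_filter, Set.mem_ofPred_eq]
      refine ⟨Finset.mem_erase.2 ⟨fun h3 => ?_, Finset.mem_univ _⟩, h1⟩
      -- The ground set has at least `k` elements, so it is not counted among the small flats.
      rw [show F = M.E from congrArg Subtype.val h3] at h2
      exact h2.not_ge hM.le_ncard
  · intro F hF
    rw [Finset.mem_filter] at hF
    rw [h F (hlt F hF.1), hF.2]

open Classical in
-- All subsets of such an `F` are flats, so the interval below it is a Boolean lattice.
theorem IsUniform.mu_of_ncard_lt (hM : IsUniform M k) (F : Flat M) (hF : F.1.ncard < k) :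
    IncidenceAlgebra.mu ℤ (botFlat M) F = (-1) ^ F.1.ncard := by
  have hbot : (botFlat M).1 = ∅ :=
    (hM.isFlat (Set.empty_subset _) (by simpa using Nat.zero_lt_of_lt hF)).closure
  have hle : ∀ G : Flat M, botFlat M ≤ G := fun G => by
    change (botFlat M).1 ⊆ G.1
    rw [hbot]; exact Set.empty_subset _
  induction hn : F.1.ncard using Nat.strong_induction_on generalizing F with
  | _ n ih =>
    by_cases h0 : botFlat M = F
    · rw [← h0, IncidenceAlgebra.mu_self, ← hn, ← h0, hbot]
      simp
    · have hfin := F.1.toFinite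
      have h1 : ∑ G ∈ Finset.Icc (botFlat M) F, (-1 : ℤ) ^ G.1.ncard = 0 := by
        have h2 : hfin.toFinset.Nonempty := by
          rw [Set.Finite.toFinset_nonempty, Set.nonempty_iff_ne_empty]
          exact fun h3 => h0 (Subtype.ext (hbot.trans h3.symm))
        rw [← Finset.sum_powerset_neg_one_pow_card_of_nonempty h2]
        refine Finset.sum_bij (fun G _ => (G.1.toFinite).toFinset) ?_ ?_ ?_ ?_
        · intro G hG
          rw [Finset.mem_powerset, Set.Finite.toFinset_subset_toFinset]
          exact (Finset.mem_Icc.1 hG).2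
        · intro G _ G' _ h
          exact Subtype.ext (Set.Finite.toFinset_inj.1 h)
        · intro S hS
          rw [Finset.mem_powerset, Set.Finite.subset_toFinset] at hS
          have h4 : (S : Set α).ncard ≤ F.1.ncard := Set.ncard_le_ncard hS hfin
          refine ⟨⟨S, hM.isFlat (hS.trans F.2.subset_ground) (by omega)⟩,
            Finset.mem_Icc.2 ⟨hle _, hS⟩, ?_⟩
          simp
        · intro G _
          rw [Set.ncard_eq_toFinset_card _ G.1.toFinite]
      have h2 := IncidenceAlgebra.mu_eq_neg_sum_Ico_of_ne (𝕜 := ℤ) h0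
      rw [← Finset.Ico_insert_right (hle F), Finset.sum_insert (by simp), hn] at h1
      rw [h2, eq_comm, eq_neg_iff_add_eq_zero, ← h1]
      congr 1
      refine Finset.sum_congr rfl fun G hG => ?_
      have h3 : G.1 ⊂ F.1 := (Finset.mem_Ico.1 hG).2
      have h4 := Set.ncard_lt_ncard h3 hfin
      exact ih _ (by omega) G (by omega) rfl

/-- The Möbius function sums to zero over the lattice. The proper flats contribute a truncated
alternating sum of binomial coefficients, which is itself a signed binomial coefficient. -/
theorem IsUniform.mobius_eq (hM : IsUniform M k) (hk : 0 < k) :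
    mobius M = (-1) ^ k * (M.E.ncard - 1).choose (k - 1) := by
  classical
  obtain ⟨k, rfl⟩ : ∃ l, k = l + 1 := ⟨k - 1, by omega⟩
  have hbot : (botFlat M).1 = ∅ :=
    (hM.isFlat (Set.empty_subset _) (by simp)).closure
  have h0 : botFlat M ≠ topFlat M := fun h => by
    have h1 : M.E = ∅ := (congrArg Subtype.val h).symm.trans hbot
    have := hM.le_ncard
    simp [h1] at this
  have h1 : Finset.Icc (botFlat M) (topFlat M) = Finset.univ := by
    refine Finset.eq_univ_of_forall fun F => Finset.mem_Icc.2 ⟨?_, F.2.subset_ground⟩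
    change (botFlat M).1 ⊆ F.1
    rw [hbot]; exact Set.empty_subset _
  have h2 := IncidenceAlgebra.sum_Icc_mu_right (𝕜 := ℤ) (botFlat M) (topFlat M)
  rw [if_neg h0, h1, hM.sum_flat _ (fun j => (-1) ^ j) fun F hF => hM.mu_of_ncard_lt F hF] at h2
  obtain ⟨n, hn⟩ : ∃ n, M.E.ncard = n + 1 := ⟨M.E.ncard - 1, by have := hM.le_ncard; omega⟩
  have h3 := Int.alternating_sum_range_choose_eq_choose (n := n) (m := k)
  simp only [mul_comm ((-1 : ℤ) ^ _)] at h3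
  rw [hn, h3] at h2
  rw [hn, mobius, Nat.add_sub_cancel, Nat.add_sub_cancel, pow_succ]
  linear_combination h2

/-! ### Identification of the invariants with the closed forms. -/

theorem IsUniform.zSum_kl (hM : IsUniform M k) (f : ℕ → ℤ[X])
    (hf : ∀ F : Flat M, F.1.ncard < k → kl (M ／ F.1) = f F.1.ncard) :
    zSum kl M = X ^ k + ∑ j ∈ Finset.range k, (M.E.ncard.choose j : ℤ[X]) * (X ^ j * f j) := by
  rw [zSum, hM.sum_flat _ (fun j => X ^ j * f j)]
  · simp [topFlat, hM.rk_eq, kl_of_ground_eq_empty (M := M ／ M.E) (by simp)]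
  · intro F hF
    rw [(hM.restrict F.2.subset_ground hF.le).rk_eq, hf F hF]

/-- The hypothesis on restrictions lets this serve inside the induction of `invKL_eq_one`, which
afterwards removes it. -/
theorem IsUniform.ySum_invKL_eq_sum (hM : IsUniform M k)
    (h : ∀ F : Flat M, F.1.ncard < k → invKL (M ↾ F.1) = 1) :
    ySum invKL M = invKL M + unifTail k M.E.ncard := by
  rw [ySum, hM.sum_flat _ (fun j => ((M.E.ncard - j - 1).choose (k - j - 1) : ℤ[X]) *
    X ^ (k - j)), unifTail]
  · congr 1
    simp [topFlat, mobius_of_ground_eq_empty (M ／ M.E) (by simp)]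
  · intro F hF
    have h1 := hM.contract F.2.subset_ground hF.le
    rw [h F hF, (hM.restrict F.2.subset_ground hF.le).rk_eq, hM.rk_eq, h1.mobius_eq (by omega),
      ncard_ground_contract F.2.subset_ground, ← mul_assoc, ← mul_pow]
    simp

/-- In the Boolean case `1` completes the tail to the palindromic polynomial `(1 + X) ^ k`. -/
theorem IsUniform.invKL_eq_one (hM : IsUniform M k) (h : M.E.ncard = k) : invKL M = 1 := by
  induction k using Nat.strong_induction_on generalizing M with
  | _ k ih =>
    rcases Nat.eq_zero_or_pos k with rfl | hk
    · exact invKL_of_ground_eq_empty ((Set.ncard_eq_zero).1 h)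
    · have hl := hM.loopless (.inl hk)
      have h1 := (isKLFamily_invKL α).isPalindromic M hl
      have h2 := (isKLFamily_invKL α).two_mul_natDegree_lt M hl (hM.rk_eq.symm ▸ hk)
      rw [hM.ySum_invKL_eq_sum fun F hF => ih _ hF (hM.restrict F.2.subset_ground hF.le) rfl,
        hM.rk_eq, h] at h1
      rw [hM.rk_eq] at h2
      rw [(eq_completion_iff (natDegree_unifTail_le k k) h2).1 h1, eq_comm,
        ← eq_completion_iff (natDegree_unifTail_le k k) (by simpa using hk),
        one_add_unifTail_self, ← mul_one ((1 + X) ^ k)]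
      exact isPalindromic_one_add_X_pow_mul (d := 0) (by simp [IsPalindromic]) k

theorem IsUniform.ySum_invKL (hM : IsUniform M k) :
    ySum invKL M = invKL M + unifTail k M.E.ncard :=
  hM.ySum_invKL_eq_sum fun F hF => (hM.restrict F.2.subset_ground hF.le).invKL_eq_one rfl

theorem IsUniform.invKL_eq (hM : IsUniform M k) (hk : 0 < k) :
    invKL M = unifInvKL k M.E.ncard := by
  have hl := hM.loopless (.inl hk)
  have h1 := (isKLFamily_invKL α).isPalindromic M hl
  have h2 := (isKLFamily_invKL α).two_mul_natDegree_lt M hl (hM.rk_eq.symm ▸ hk)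
  rw [hM.ySum_invKL, hM.rk_eq] at h1
  rw [hM.rk_eq] at h2
  exact (eq_completion_iff (natDegree_unifTail_le k _) h2).1 h1

theorem IsUniform.kl_eq (hM : IsUniform M k) (hk : 0 < k) : kl M = unifKL k M.E.ncard := by
  induction k using Nat.strong_induction_on generalizing M with
  | _ k ih =>
    have hl := hM.loopless (.inl hk)
    have h1 := (isKLFamily_kl α).isPalindromic M hl
    have h2 := (isKLFamily_kl α).two_mul_natDegree_lt M hl (hM.rk_eq.symm ▸ hk)
    rw [hM.rk_eq] at h1 h2
    have h3 := isPalindromic_unifKL hk hM.le_ncard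
    -- Contracting the empty flat gives `M` itself, beyond the induction hypothesis. With that term
    -- split off, `kl M` and `unifKL` complete the same remainder.
    rw [hM.zSum_kl (fun j => if j = 0 then kl M else unifKL (k - j) (M.E.ncard - j))] at h1
    · obtain ⟨l, rfl⟩ : ∃ l, k = l + 1 := ⟨k - 1, by omega⟩
      rw [Finset.sum_range_succ'] at h1 h3
      simp only [Nat.add_eq_zero_iff, one_ne_zero, and_false, if_false, if_true, pow_zero, one_mul,
        Nat.choose_zero_right, Nat.cast_one, Nat.sub_zero] at h1 h3
      rw [← add_assoc, add_comm _ (kl M)] at h1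
      rw [← add_assoc, add_comm _ (unifKL (l + 1) _)] at h3
      have hd : (X ^ (l + 1) + ∑ j ∈ Finset.range l, (M.E.ncard.choose (j + 1) : ℤ[X]) *
          (X ^ (j + 1) * unifKL (l + 1 - (j + 1)) (M.E.ncard - (j + 1)))).natDegree ≤ l + 1 := by
        refine (natDegree_add_le _ _).trans (max_le (natDegree_X_pow_le _)
          (natDegree_sum_le_of_forall_le _ _ fun j hj => ?_))
        rw [Finset.mem_range] at hj
        have h4 := natDegree_unifKL (k := l + 1 - (j + 1)) (by omega) (M.E.ncard - (j + 1))
        refine natDegree_mul_le.trans ?_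
        have h5 := natDegree_mul_le (p := X ^ (j + 1))
          (q := unifKL (l + 1 - (j + 1)) (M.E.ncard - (j + 1)))
        rw [natDegree_X_pow] at h5
        rw [natDegree_natCast]
        omega
      rw [(eq_completion_iff hd h2).1 h1, ← (eq_completion_iff hd (natDegree_unifKL hk _)).1 h3]
    · intro F hF
      split_ifs with h4
      · rw [(Set.ncard_eq_zero).1 h4, Matroid.contract_empty]
      · rw [ih (k - F.1.ncard) (by omega) (hM.contract F.2.subset_ground hF.le) (by omega),
          ncard_ground_contract F.2.subset_ground]

theorem IsUniform.tau_eq (hM : IsUniform M k) :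
    tau M = if Odd k then (invKL M).coeff ((k - 1) / 2) else 0 := by
  rw [tau, hM.rk_eq]
  refine if_ctx_congr Iff.rfl (fun h => ?_) fun _ => rfl
  rw [hM.kl_eq h.pos, hM.invKL_eq h.pos, coeff_unifKL_of_odd h]

theorem invKL_of_not_loopless (h : ¬ M.Loopless) : invKL M = 0 :=
  (isKLFamily_invKL α).of_not_loopless M h

theorem IsUniform.not_loopless (hM : IsUniform M 0) (h : M.E ≠ ∅) : ¬ M.Loopless := fun hl =>
  h (ground_eq_empty hl hM.rk_eq)

/-! ### The recurrence. -/

theorem isUniform_uniform {k n : ℕ} (h : k ≤ n) : IsUniform (uniform k n) k where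
  indep_iff I := by
    change I.ncard ≤ k ↔ I ⊆ Set.univ ∧ _
    simp
  le_ncard := by
    change k ≤ (Set.univ : Set (Fin n)).ncard
    simpa [Set.ncard_univ] using h

theorem ncard_ground_uniform (k n : ℕ) : (uniform k n).E.ncard = n := by
  change (Set.univ : Set (Fin n)).ncard = n
  simp [Set.ncard_univ]

theorem invZ_uniform {k n : ℕ} (h : k ≤ n) :
    invZ (uniform k n) = invKL (uniform k n) + unifTail k n := by
  rw [invZ, (isUniform_uniform h).ySum_invKL, ncard_ground_uniform]

theorem invKL_uniform {k n : ℕ} (hk : 0 < k) (h : k ≤ n) :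
    invKL (uniform k n) = unifInvKL k n := by
  rw [(isUniform_uniform h).invKL_eq hk, ncard_ground_uniform]

/-- Both sides are `0`: the matroid has loops, and a completion in degree `0` is an empty sum. For
`n = 0` the left side would be `1`. -/
theorem invKL_uniform_zero {n : ℕ} (hn : 0 < n) : invKL (uniform 0 n) = unifInvKL 0 n := by
  rw [invKL_of_not_loopless ((isUniform_uniform n.zero_le).not_loopless fun h => ?_)]
  · simp [unifInvKL, completion]
  · have := ncard_ground_uniform 0 n
    rw [h, Set.ncard_empty] at this
    omega

theorem two_mul_natDegree_unifInvKL_le (k n : ℕ) : 2 * (unifInvKL k n).natDegree ≤ k - 1 := by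
  rcases Nat.eq_zero_or_pos k with rfl | hk
  · simp [unifInvKL, completion]
  · have := natDegree_completion hk (unifTail k n)
    rw [unifInvKL]
    omega

/-- The recurrence for the inverse Kazhdan–Lusztig polynomials of uniform matroids. -/
theorem unifInvKL_succ_succ {k n : ℕ} (h : k + 1 ≤ n) :
    unifInvKL (k + 1) (n + 1) = unifInvKL (k + 1) n + (1 + X) * unifInvKL k n -
      C (if Odd k then (unifInvKL k n).coeff ((k - 1) / 2) else 0) * X ^ ((k + 1) / 2) := by
  have h1 : IsPalindromic (k + 1)
      (unifInvKL (k + 1) (n + 1) - unifInvKL (k + 1) n - (1 + X) * unifInvKL k n) := by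
    have h2 := isPalindromic_one_add_X_pow_mul (isPalindromic_unifInvKL_add_unifTail k n) 1
    rw [pow_one, add_comm 1 k] at h2
    have h3 := ((isPalindromic_unifInvKL_add_unifTail (k + 1) (n + 1)).sub
      (isPalindromic_unifInvKL_add_unifTail (k + 1) n)).sub h2
    rw [unifTail_succ_succ h] at h3
    convert h3 using 1
    ring
  have h2 : 2 * (unifInvKL (k + 1) (n + 1) - unifInvKL (k + 1) n -
      (1 + X) * unifInvKL k n).natDegree ≤ k + 1 := by
    have h4 := two_mul_natDegree_unifInvKL_le (k + 1) (n + 1)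
    have h5 := two_mul_natDegree_unifInvKL_le (k + 1) n
    have h6 := two_mul_natDegree_unifInvKL_le k n
    have h7 : ((1 : ℤ[X]) + X).natDegree ≤ 1 := by compute_degree
    have h8 := natDegree_mul_le (p := 1 + X) (q := unifInvKL k n)
    have h9 := natDegree_sub_le (unifInvKL (k + 1) (n + 1)) (unifInvKL (k + 1) n)
    have h10 := natDegree_sub_le (unifInvKL (k + 1) (n + 1) - unifInvKL (k + 1) n)
      ((1 + X) * unifInvKL k n)
    -- For `k = 0` the general bound on the degree of the product is too weak, but the product is
    -- zero.
    rcases Nat.eq_zero_or_pos k with rfl | hk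
    · have h11 : unifInvKL 0 n = 0 := by simp [unifInvKL, completion]
      rw [h11, mul_zero, natDegree_zero] at h10
      rw [h11, mul_zero]
      omega
    · omega
  have h3 := h1.eq_C_mul_X_pow h2
  suffices h4 : (if Even (k + 1) then (unifInvKL (k + 1) (n + 1) - unifInvKL (k + 1) n -
      (1 + X) * unifInvKL k n).coeff ((k + 1) / 2) else 0) =
      -(if Odd k then (unifInvKL k n).coeff ((k - 1) / 2) else 0) by
    rw [h4, C_neg] at h3
    linear_combination h3
  simp only [Nat.even_add_one, Nat.not_even_iff_odd]
  split_ifs with hk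
  · obtain ⟨a, rfl⟩ := hk
    -- At `x^(a+1)` all three polynomials `unifInvKL` vanish by degree; only the shift by `X` in `1
    -- + X` brings in the coefficient at `x^a`.
    rw [show (2 * a + 1 + 1) / 2 = a + 1 by omega, show (2 * a + 1 - 1) / 2 = a by omega,
      coeff_sub, coeff_sub, add_mul, one_mul, coeff_add, coeff_X_mul]
    simp only [unifInvKL, coeff_completion]
    rw [if_neg (by omega), if_neg (by omega), if_neg (by omega)]
    ring
  · simp

end MatroidKL

open MatroidKL in
theorem proposition4p1 (k n : ℕ) (hk : 0 < k) (hkn : k < n) :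
    MatroidKL.invKL (MatroidKL.uniform k n) =
        MatroidKL.invKL (MatroidKL.uniform k (n - 1)) +
          (1 + X) * MatroidKL.invKL (MatroidKL.uniform (k - 1) (n - 1)) -
          C (MatroidKL.tau (MatroidKL.uniform (k - 1) (n - 1))) * X ^ (k / 2) ∧
      MatroidKL.invZ (MatroidKL.uniform k n) =
        MatroidKL.invZ (MatroidKL.uniform k (n - 1)) +
          (1 + X) * MatroidKL.invZ (MatroidKL.uniform (k - 1) (n - 1)) -
          C (MatroidKL.tau (MatroidKL.uniform (k - 1) (n - 1))) * X ^ (k / 2) := by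
  obtain ⟨k, rfl⟩ : ∃ l, k = l + 1 := ⟨k - 1, by omega⟩
  obtain ⟨n, rfl⟩ : ∃ l, n = l + 1 := ⟨n - 1, by omega⟩
  change invKL (uniform (k + 1) (n + 1)) = invKL (uniform (k + 1) n) +
      (1 + X) * invKL (uniform k n) - C (tau (uniform k n)) * X ^ ((k + 1) / 2) ∧
    invZ (uniform (k + 1) (n + 1)) = invZ (uniform (k + 1) n) +
      (1 + X) * invZ (uniform k n) - C (tau (uniform k n)) * X ^ ((k + 1) / 2)
  have h : k + 1 ≤ n := by omega
  have h0 : invKL (uniform k n) = unifInvKL k n := by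
    rcases Nat.eq_zero_or_pos k with rfl | hk
    · exact invKL_uniform_zero h
    · exact invKL_uniform hk (by omega)
  have h1 := unifInvKL_succ_succ h
  rw [invZ_uniform hkn.le, invZ_uniform h, invZ_uniform (show k ≤ n by omega),
    (isUniform_uniform (show k ≤ n by omega)).tau_eq, h0, invKL_uniform hk hkn.le,
    invKL_uniform hk h, unifTail_succ_succ h]
  -- The tails cancel by their recurrence, so the second identity reduces to the first.
  exact ⟨h1, by linear_combination h1⟩
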